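/- Let $N,d_0,d_1,d_2\ge 1$ be integers, let $X\in\mathbb R^{N\times d_0}$ and $Y\in\mathbb R^{N\times d_2}$ be fixed matrices, and let $\phi(x)=\max(x,0)$ act on matrices entrywise. For $\theta=(W,V)\in\mathbb R^{D}$, $D=d_0d_1+d_1d_2$, where $W\in\mathbb R^{d_0\times d_1}$ and $V\in\mathbb R^{d_1\times d_2}$ are identified with their vectorized forms, put $$H(\theta)=\phi(XW)\in\mathbb R^{N\times d_1},\qquad \mathcal L(\theta)=\tfrac12\|Y-\phi(XW)V\|_F^2 .$$ Let $\partial\mathcal L(\theta)$ be the Clarke subdifferential, i.e. the convex hull of all limits $\lim_n\nabla\mathcal L(\theta_n)$ along sequences $\theta_n\to\theta$ of points of differentiability of $\mathcal L$. For a matrix $A$ let $\sigma_{\min}(A)=\sqrt{\lambda_{\min}(A^TA)}$, where $\lambda_{\min}$ is the smallest eigenvalue. For $\theta_0\in\mathbb R^D$ and $T\in(0,\infty]$, a solution on $[0,T)$ of the differential inclusion $$\theta(0)=\theta_0,\qquad \dot\theta(t)\in-\partial\mathcal L(\theta(t))\ \text{ for a.e. } t\in[0,T) \qquad (*)$$ means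 a curve $\theta\colon[0,T)\to\mathbb R^D$ that is absolutely continuous (there is $v$, integrable on each $[0,t]$ with $t<T$, such that $\theta(t)-\theta(0)=\int_0^tv(s)\,ds$ for all $t\in[0,T)$) and satisfies $(*)$. Then for every $\theta_0\in\mathbb R^D$: 1. There are $T>0$ and a solution $\theta\colon[0,T)\to\mathbb R^D$ of $(*)$. 2. For every bounded domain (bounded, open, connected set) $G\ni\theta_0$, every $T\in(0,\infty]$ and every solution $\theta$ of $(*)$ on $[0,T)$, there are $T'\in[T,\infty]$ and a solution $\theta'$ of $(*)$ on $[0,T')$ with $\theta'=\theta$ on $[0,T)$ such that $T'=\infty$ or $\theta'(t)\in\partial G$ (the topological boundary of $G$) for some $t\in[0,T')$. 3. For every $T\in(0,\infty]$ and every solution $\theta$ of $(*)$ on $[0,T)$, and for every $t\in[0,T)$, the function $s\mapsto\sigma_{\min}(H(\theta(s))^T)^2$ is integrable on $[0,t]$ and $$\mathcal L(\theta(t))\le\mathcal L(\theta(0))\exp\Big(-2\int_0^t\sigma_{\min}\big(H(\theta(s))^T\big)^2\,ds\Big).$$ -/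

import Mathlib

open Set Filter Topology MeasureTheory

namespace ReluNet

noncomputable section

/-- The Clarke subdifferential of a (locally Lipschitz) function on a Euclidean space: the convex
hull of all limits of gradients along sequences of differentiability points converging to `x`. -/
def clarkeSubdifferential {ι : Type*} [Fintype ι] (f : EuclideanSpace ℝ ι → ℝ)
    (x : EuclideanSpace ℝ ι) : Set (EuclideanSpace ℝ ι) :=
  convexHull ℝ {v | ∃ u : ℕ → EuclideanSpace ℝ ι,
    (∀ n, DifferentiableAt ℝ f (u n)) ∧ Tendsto u atTop (𝓝 x) ∧
      Tendsto (fun n => gradient f (u n)) atTop (𝓝 v)}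

/-- `x` is an arc (an absolutely continuous curve) on `[0, T)`, where `T = ⊤` is allowed: it is the
integral of a map `v` that is integrable on every compact interval `[0, t]` with `t < T`. -/
def IsArc {ι : Type*} [Fintype ι] (T : EReal) (x : ℝ → EuclideanSpace ℝ ι) : Prop :=
  ∃ v : ℝ → EuclideanSpace ℝ ι, ∀ t : ℝ, 0 ≤ t → (t : EReal) < T →
    IntervalIntegrable v volume 0 t ∧ x t - x 0 = ∫ s in (0 : ℝ)..t, v s

/-- `x` is a solution on `[0, T)` of the differential inclusion Cauchy problem
`x 0 = x₀`, `x' t ∈ -∂f (x t)` for almost every `t`. Only the values of `x` on `[0, T)` matter. -/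
structure IsSolution {ι : Type*} [Fintype ι] (f : EuclideanSpace ℝ ι → ℝ)
    (x₀ : EuclideanSpace ℝ ι) (T : EReal) (x : ℝ → EuclideanSpace ℝ ι) : Prop where
  initial : x 0 = x₀
  arc : IsArc T x
  inclusion : ∀ᵐ t : ℝ, 0 ≤ t → (t : EReal) < T →
    ∃ d : EuclideanSpace ℝ ι, HasDerivAt x d t ∧ -d ∈ clarkeSubdifferential f (x t)

/-- The parameter space `ℝ^D`, `D = d₀ d₁ + d₁ d₂`, with its Euclidean norm; the coordinates are
the entries of the weight matrices `W` (left summand) and `V` (right summand). -/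
abbrev Params (d₀ d₁ d₂ : ℕ) : Type :=
  EuclideanSpace ℝ ((Fin d₀ × Fin d₁) ⊕ (Fin d₁ × Fin d₂))

variable {N d₀ d₁ d₂ : ℕ}

/-- The first-layer weight matrix. -/
def weightW (θ : Params d₀ d₁ d₂) : Matrix (Fin d₀) (Fin d₁) ℝ :=
  Matrix.of fun i j => θ (Sum.inl (i, j))

/-- The second-layer weight matrix. -/
def weightV (θ : Params d₀ d₁ d₂) : Matrix (Fin d₁) (Fin d₂) ℝ :=
  Matrix.of fun j k => θ (Sum.inr (j, k))

/-- The ReLU activation function. -/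
def relu (x : ℝ) : ℝ := max x 0

/-- The hidden layer `H = φ(X W)`, with ReLU applied entrywise. -/
def hidden (X : Matrix (Fin N) (Fin d₀) ℝ) (θ : Params d₀ d₁ d₂) : Matrix (Fin N) (Fin d₁) ℝ :=
  (X * weightW θ).map relu

/-- The network output `φ(X W) V`. -/
def output (X : Matrix (Fin N) (Fin d₀) ℝ) (θ : Params d₀ d₁ d₂) : Matrix (Fin N) (Fin d₂) ℝ :=
  hidden X θ * weightV θ

/-- The MSE loss, half the squared Frobenius norm of `Y - φ(X W) V`. -/
def mseLoss (X : Matrix (Fin N) (Fin d₀) ℝ) (Y : Matrix (Fin N) (Fin d₂) ℝ)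
    (θ : Params d₀ d₁ d₂) : ℝ :=
  1 / 2 * ∑ i, ∑ k, (Y i k - output X θ i k) ^ 2

/-- The minimal eigenvalue of a (nonempty, symmetric) real matrix. -/
def lambdaMin {n : ℕ} (A : Matrix (Fin n) (Fin n) ℝ) : ℝ := sInf (spectrum ℝ A)

/-- The minimal singular value `σ_min(A) = √(λ_min(Aᵀ A))`. -/
def sigmaMin {m n : ℕ} (A : Matrix (Fin m) (Fin n) ℝ) : ℝ :=
  Real.sqrt (lambdaMin (A.transpose * A))

end

end ReluNet

open Set Filter Topology MeasureTheory

namespace ReluNet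

set_option linter.unusedSectionVars false

/-! ### Continuous selections of smooth functions and their Clarke subdifferential -/

section PiecewiseSmooth

variable {E κ : Type*} [NormedAddCommGroup E] [InnerProductSpace ℝ E] [FiniteDimensional ℝ E]

/-! The loss is a continuous selection of finitely many polynomials, one per activation pattern. For
such an `f`, the Clarke subdifferential at `x` is the convex hull of the gradients of the pieces
that agree with `f` on open sets accumulating at `x` (`clarkeSubdifferential_eq`). It is therefore
compact, convex and upper semicontinuous in `x`.

Existence uses implicit Euler steps: a minimizer of `f y + ‖y - x‖ ^ 2 / (2 * τ)` solves the
discrete inclusion, and the decrease of `f ≥ 0` bounds the distance travelled in finite time. Limits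
of these polygons are global solutions (`exists_curve`).

Along any solution `θ`, `f ∘ θ` is absolutely continuous. Where it meets a piece evaluated along
`θ`, the two derivatives, when they exist, differ at countably many times only. So at almost every
time all active gradients have the same inner product with `θ'`, and `-θ'` lies in their hull; hence
`(f ∘ θ)' = -‖θ'‖ ^ 2`. As `‖θ'‖ ≤ (1 + ‖θ'‖ ^ 2) / 2`, a solution has finite length on bounded
intervals. It can be glued at its endpoint to a global one, so every solution extends to `T' = ⊤`.

For the loss bound, put `H = φ(XW)` and `R = Y - HV`. The loss is quadratic in `V` with partial
gradient `-HᵀR`, continuous in `θ`, so this is the `V`-part of every subgradient `g`. Thus `‖g‖ ^ 2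
≥ ‖HᵀR‖ ^ 2 ≥ λ_min(HHᵀ) ‖R‖ ^ 2`, which is `2 σ_min(Hᵀ) ^ 2` times the loss, and Grönwall's
inequality concludes. -/

theorem _root_.HasGradientAt.comp_hasDerivAt {f : E → ℝ} {g d : E} {γ : ℝ → E}
    {t : ℝ} (hf : HasGradientAt f g (γ t)) (hγ : HasDerivAt γ d t) :
    HasDerivAt (fun s => f (γ s)) (inner ℝ g d) t := by
  have := hf.hasFDerivAt.comp_hasDerivAt t hγ
  rwa [InnerProductSpace.toDual_apply_apply] at this

theorem _root_.hasDerivAt_const_add_smul (x d : E) (t : ℝ) :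
    HasDerivAt (fun s : ℝ => x + s • d) d t := by
  simpa using ((hasDerivAt_id t).smul_const d).const_add x

/-- The pieces `p S` that agree with `f` on an open set accumulating at `x`. -/
def activePieces (f : E → ℝ) (p : κ → E → ℝ) (x : E) : Set κ :=
  {S | x ∈ closure (interior {y | f y = p S y})}

/-- The convex hull of the gradients of the active pieces. -/
noncomputable def activeHull (f : E → ℝ) (p : κ → E → ℝ) (x : E) : Set E :=
  convexHull ℝ ((fun S => gradient (p S) x) '' activePieces f p x)

/-- `f` is a continuous selection of the continuously differentiable functions `p S`. -/
structure IsPiecewiseSmooth (f : E → ℝ) (p : κ → E → ℝ) : Prop where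
  continuous : Continuous f
  contDiff : ∀ S, ContDiff ℝ 1 (p S)
  exists_eq : ∀ x, ∃ S, f x = p S x

namespace IsPiecewiseSmooth

variable {f : E → ℝ} {p : κ → E → ℝ}

theorem isClosed_eq (h : IsPiecewiseSmooth f p) (S : κ) : IsClosed {y | f y = p S y} :=
  _root_.isClosed_eq h.continuous (h.contDiff S).continuous

theorem eq_of_mem_activePieces (h : IsPiecewiseSmooth f p) {S : κ} {x : E}
    (hS : S ∈ activePieces f p x) : f x = p S x :=
  closure_minimal interior_subset (h.isClosed_eq S) hS

theorem hasGradientAt (h : IsPiecewiseSmooth f p) (S : κ) (x : E) :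
    HasGradientAt (p S) (gradient (p S) x) x :=
  (((h.contDiff S).differentiable one_ne_zero) x).hasGradientAt

theorem continuous_gradient (h : IsPiecewiseSmooth f p) (S : κ) :
    Continuous (gradient (p S)) :=
  (InnerProductSpace.toDual ℝ E).symm.continuous.comp
    ((h.contDiff S).continuous_fderiv one_ne_zero)

theorem hasDerivAt_line (h : IsPiecewiseSmooth f p) (S : κ) (x d : E) (t : ℝ) :
    HasDerivAt (fun s : ℝ => p S (x + s • d)) (inner ℝ (gradient (p S) (x + t • d)) d) t :=
  (h.hasGradientAt S _).comp_hasDerivAt (hasDerivAt_const_add_smul x d t)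

/-- Finitely many closed agreement sets cover the space, so by Baire their interiors have dense
union; finiteness lets the closure pass inside the union. -/
theorem exists_active [Finite κ] (h : IsPiecewiseSmooth f p) (x : E) :
    (activePieces f p x).Nonempty := by
  have h1 : Dense (⋃ S, interior {y | f y = p S y}) :=
    dense_iUnion_interior_of_closed h.isClosed_eq (by
      ext x; simpa using h.exists_eq x)
  have h2 := h1 x
  rw [closure_iUnion_of_finite] at h2
  obtain ⟨S, hS⟩ := mem_iUnion.1 h2
  exact ⟨S, hS⟩

theorem eventually_activePieces_subset [Finite κ] (x : E) :
    ∀ᶠ y in 𝓝 x, activePieces f p y ⊆ activePieces f p x := by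
  have : ∀ S, ∀ᶠ y in 𝓝 x, S ∈ activePieces f p y → S ∈ activePieces f p x := by
    intro S
    by_cases hS : S ∈ activePieces f p x
    · simp [hS]
    · have : ∀ᶠ y in 𝓝 x, y ∉ closure (interior {y | f y = p S y}) :=
        isClosed_closure.isOpen_compl.mem_nhds hS
      filter_upwards [this] with y hy hy'
      exact absurd hy' hy
  filter_upwards [eventually_all.2 this] with y hy S hS using hy S hS

theorem isCompact_activeHull [Finite κ] (x : E) : IsCompact (activeHull f p x) :=
  ((toFinite (activePieces f p x)).image _).isCompact_convexHull (𝕜 := ℝ)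

theorem convex_activeHull (x : E) : Convex ℝ (activeHull f p x) := convex_convexHull _ _

/-- Upper semicontinuity: near `x` no new piece becomes active and the finitely many gradients move
little. Closed thickenings of convex sets are convex, so the hull stays inside. -/
theorem eventually_activeHull_subset_cthickening [Finite κ] (h : IsPiecewiseSmooth f p) (x : E)
    {ε : ℝ} (hε : 0 < ε) :
    ∀ᶠ y in 𝓝 x, activeHull f p y ⊆ Metric.cthickening ε (activeHull f p x) := by
  have h1 : ∀ S, ∀ᶠ y in 𝓝 x, dist (gradient (p S) y) (gradient (p S) x) ≤ ε := fun S =>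
    ((h.continuous_gradient S).tendsto x).eventually (Metric.closedBall_mem_nhds _ hε)
  filter_upwards [eventually_all.2 h1, eventually_activePieces_subset (f := f) (p := p) x] with y hy hA
  refine convexHull_min ?_ ((convex_activeHull x).cthickening ε)
  rintro _ ⟨S, hS, rfl⟩
  exact Metric.mem_cthickening_of_dist_le _ _ _ _
    (subset_convexHull ℝ _ ⟨S, hA hS, rfl⟩) (hy S)

theorem exists_norm_le [Finite κ] (h : IsPiecewiseSmooth f p) (x : E) (R : ℝ) :
    ∃ M : ℝ, 0 ≤ M ∧ ∀ y ∈ Metric.closedBall x R, ∀ g ∈ activeHull f p y, ‖g‖ ≤ M := by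
  have h1 : ∀ S, ∃ M : ℝ, ∀ y ∈ Metric.closedBall x R, ‖gradient (p S) y‖ ≤ M := fun S =>
    (isCompact_closedBall x R).exists_bound_of_continuousOn (h.continuous_gradient S).continuousOn
  choose M hM using h1
  obtain ⟨B, hB⟩ := (finite_range M).bddAbove
  refine ⟨max B 0, le_max_right _ _, fun y hy g hg => ?_⟩
  have : activeHull f p y ⊆ Metric.closedBall 0 (max B 0) := by
    refine convexHull_min ?_ (convex_closedBall _ _)
    rintro _ ⟨S, -, rfl⟩
    simpa using Or.inl ((hM S y hy).trans (hB ⟨S, rfl⟩))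
  simpa using this hg

/-- A continuous selection grows along a segment no faster than its active pieces. -/
theorem line_le [Finite κ] (h : IsPiecewiseSmooth f p) {x d : E} {c τ : ℝ} (hτ : 0 ≤ τ)
    (hc : ∀ t ∈ Ico 0 τ, ∀ S ∈ activePieces f p (x + t • d),
      inner ℝ (gradient (p S) (x + t • d)) d ≤ c) :
    f (x + τ • d) ≤ f x + c * τ := by
  have hline : Continuous fun t : ℝ => x + t • d := by fun_prop
  have key := image_le_of_liminf_slope_right_le_deriv_boundary
    (f := fun t : ℝ => f (x + t • d)) (a := 0) (b := τ) (B := fun t => f x + c * t)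
    (B' := fun _ => c) (h.continuous.comp hline).continuousOn (by simp) (by fun_prop)
    (fun t _ => by
      simpa using (((hasDerivAt_id t).const_mul c).const_add (f x)).hasDerivWithinAt) ?_
  · simpa using key (right_mem_Icc.2 hτ)
  intro t ht r hr
  -- By pigeonhole one piece is active at times arbitrarily close to `t` on the right; along these
  -- times the slope of `f` is that of the piece.
  obtain ⟨S, hS⟩ : ∃ S, ∃ᶠ z in 𝓝[>] t, S ∈ activePieces f p (x + z • d) := by
    by_contra hcon
    push Not at hcon
    have h1 := eventually_all.2 hcon
    obtain ⟨z, hz⟩ := h1.exists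
    obtain ⟨S, hS⟩ := h.exists_active (x + z • d)
    exact hz S hS
  have hSt : S ∈ activePieces f p (x + t • d) := by
    have hcl : IsClosed {z : ℝ | S ∈ activePieces f p (x + z • d)} :=
      isClosed_closure.preimage hline
    have : t ∈ closure {z : ℝ | S ∈ activePieces f p (x + z • d)} :=
      mem_closure_iff_frequently.2 (hS.filter_mono nhdsWithin_le_nhds)
    rwa [hcl.closure_eq] at this
  have hslope : ∀ᶠ z in 𝓝[>] t, slope (fun s : ℝ => p S (x + s • d)) t z < r :=
    ((hasDerivAt_iff_tendsto_slope.1 (h.hasDerivAt_line S x d t)).mono_left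
      (nhdsWithin_mono _ fun z (hz : t < z) => hz.ne')).eventually
      (gt_mem_nhds ((hc t ht S hSt).trans_lt hr))
  refine (hS.and_eventually hslope).mono fun z hz => ?_
  have e1 := h.eq_of_mem_activePieces hz.1
  have e2 := h.eq_of_mem_activePieces hSt
  simpa [slope, e1, e2] using hz.2

/-- A lower directional subgradient lies in the convex hull of the active gradients. -/
theorem mem_activeHull [Finite κ] (h : IsPiecewiseSmooth f p) {x g : E}
    (hg : ∀ d : E, ∀ ε > 0, ∀ᶠ t : ℝ in 𝓝[>] 0,
      f x + t * (inner ℝ g d - ε) ≤ f (x + t • d)) :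
    g ∈ activeHull f p x := by
  by_contra hcon
  -- A functional separating `g` from the hull gives a direction `d` along which `f` grows at rate
  -- at most `u < inner ℝ g d`, against the lower bound `hg`.
  obtain ⟨l, u, hl, hu⟩ := geometric_hahn_banach_closed_point (convex_activeHull (f := f) (p := p) x)
    (isCompact_activeHull x).isClosed hcon
  set d : E := (InnerProductSpace.toDual ℝ E).symm l
  have hd : ∀ y, inner ℝ y d = l y := fun y => by
    rw [real_inner_comm, InnerProductSpace.toDual_symm_apply]
  have h1 : ∀ S ∈ activePieces f p x, ∀ᶠ y in 𝓝 x, inner ℝ (gradient (p S) y) d ≤ u := by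
    intro S hS
    have hcont : Continuous fun y => inner ℝ (gradient (p S) y) d :=
      (h.continuous_gradient S).inner continuous_const
    refine (hcont.tendsto x).eventually (ge_mem_nhds ?_)
    rw [hd]
    exact hl _ (subset_convexHull ℝ _ ⟨S, hS, rfl⟩)
  have h2 : ∀ᶠ y in 𝓝 x, ∀ S ∈ activePieces f p y, inner ℝ (gradient (p S) y) d ≤ u := by
    have h3 : ∀ᶠ y in 𝓝 x, ∀ S, S ∈ activePieces f p x → inner ℝ (gradient (p S) y) d ≤ u :=
      eventually_all.2 fun S => eventually_imp_distrib_left.2 (h1 S)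
    filter_upwards [h3, eventually_activePieces_subset (f := f) (p := p) x] with y hy hA S hS
    exact hy S (hA hS)
  have hline : Tendsto (fun t : ℝ => x + t • d) (𝓝 0) (𝓝 x) := by
    have : Continuous fun t : ℝ => x + t • d := by fun_prop
    simpa using this.tendsto 0
  obtain ⟨δ, hδ, hball⟩ := Metric.eventually_nhds_iff.1 (hline.eventually h2)
  have hlt : u < inner ℝ g d := by rw [hd]; exact hu
  obtain ⟨t, ⟨ht, ht0⟩, htδ⟩ := (((hg d ((inner ℝ g d - u) / 2) (by linarith)).and
    self_mem_nhdsWithin).and (mem_nhdsWithin_of_mem_nhds (Metric.ball_mem_nhds (0 : ℝ) hδ))).exists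
  replace ht0 : 0 < t := ht0
  have htδ' : t < δ := by simpa [abs_of_pos ht0] using htδ
  have := h.line_le (x := x) (d := d) (c := u) ht0.le fun s hs S hS => by
    refine hball (y := s) ?_ S hS
    simpa [abs_of_nonneg hs.1] using hs.2.trans htδ'
  nlinarith

theorem gradient_mem_activeHull [Finite κ] (h : IsPiecewiseSmooth f p) {x : E}
    (hx : DifferentiableAt ℝ f x) : gradient f x ∈ activeHull f p x := by
  refine h.mem_activeHull fun d ε hε => ?_
  have h3 : HasDerivAt (fun s : ℝ => f (x + s • d)) (inner ℝ (gradient f x) d) 0 := by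
    refine HasGradientAt.comp_hasDerivAt ?_ (hasDerivAt_const_add_smul x d 0)
    simpa using hx.hasGradientAt
  have h4 := ((hasDerivAt_iff_tendsto_slope.1 h3).mono_left
    (nhdsWithin_mono _ fun z (hz : (0 : ℝ) < z) => hz.ne')).eventually
      (lt_mem_nhds (show inner ℝ (gradient f x) d - ε < _ by linarith))
  filter_upwards [h4, self_mem_nhdsWithin] with t ht ht0
  have ht0' : 0 < t := ht0
  have e : slope (fun s : ℝ => f (x + s • d)) 0 t = (f (x + t • d) - f x) / t := by
    simp [slope, div_eq_inv_mul]
  rw [e, lt_div_iff₀ ht0'] at ht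
  linarith

end IsPiecewiseSmooth

end PiecewiseSmooth

/-- Gradients of `f` lie in nearby active hulls, so upper semicontinuity captures their limits.
Conversely, an active piece coincides with `f` near points tending to `x`, where its gradient is a
gradient of `f`. -/
theorem IsPiecewiseSmooth.clarkeSubdifferential_eq {ι κ : Type*} [Fintype ι] [Finite κ]
    {f : EuclideanSpace ℝ ι → ℝ} {p : κ → EuclideanSpace ℝ ι → ℝ} (h : IsPiecewiseSmooth f p)
    (x : EuclideanSpace ℝ ι) : clarkeSubdifferential f x = activeHull f p x := by
  refine Subset.antisymm (convexHull_min ?_ (convex_activeHull x)) (convexHull_mono ?_)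
  · rintro v ⟨u, hu, hux, hv⟩
    have hcl := (isCompact_activeHull (f := f) (p := p) x).isClosed
    rw [← hcl.closure_eq, Metric.closure_eq_iInter_cthickening]
    refine mem_iInter₂.2 fun ε hε => ?_
    refine Metric.isClosed_cthickening.mem_of_tendsto hv ?_
    filter_upwards [hux.eventually (h.eventually_activeHull_subset_cthickening x hε)] with n hn
    exact hn (h.gradient_mem_activeHull (hu n))
  · rintro _ ⟨S, hS, rfl⟩
    obtain ⟨u, hu, hux⟩ := mem_closure_iff_seq_limit.1 hS
    have hev : ∀ n, f =ᶠ[𝓝 (u n)] p S := fun n =>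
      mem_of_superset (isOpen_interior.mem_nhds (hu n)) interior_subset
    refine ⟨u, fun n => ?_, hux, ?_⟩
    · exact ((h.contDiff S).differentiable one_ne_zero _).congr_of_eventuallyEq (hev n)
    · simp_rw [fun n => (hev n).gradient_eq]
      exact ((h.continuous_gradient S).tendsto x).comp hux

/-! ### Global solutions by the implicit Euler scheme -/

section Existence

variable {E κ : Type*} [NormedAddCommGroup E] [InnerProductSpace ℝ E] [FiniteDimensional ℝ E]

/-- An average of the velocities of consecutive steps stays in a convex set containing them all. -/
theorem exists_mem_convex_increment {X : ℕ → E} {h : ℝ} {C : Set E} (hC : Convex ℝ C) {k : ℕ}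
    (j : ℕ) (hX : ∀ i ≤ j, ∃ g ∈ C, X (k + i + 1) - X (k + i) = -(h • g)) :
    ∃ g ∈ C, X (k + j + 1) - X k = -(((j + 1 : ℝ) * h) • g) := by
  induction j with
  | zero => simpa using hX 0 le_rfl
  | succ j ih =>
    obtain ⟨g, hg, e⟩ := ih fun i hi => hX i (hi.trans j.le_succ)
    obtain ⟨g', hg', e'⟩ := hX (j + 1) le_rfl
    have hj : (0 : ℝ) < (j : ℝ) + 2 := by positivity
    refine ⟨((j + 1 : ℝ) / (j + 2)) • g + ((1 : ℝ) / (j + 2)) • g',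
      hC hg hg' (by positivity) (by positivity) (by field_simp; ring), ?_⟩
    rw [← sub_add_sub_cancel _ (X (k + (j + 1))) _, e', ← add_assoc, e, smul_add, smul_smul,
      smul_smul]
    have e1 : (((j + 1 : ℕ) : ℝ) + 1) * h * ((j + 1) / (j + 2)) = (j + 1) * h := by
      push_cast; field_simp; ring
    have e2 : (((j + 1 : ℕ) : ℝ) + 1) * h * (1 / (j + 2)) = h := by
      push_cast; field_simp; ring
    rw [e1, e2]; abel

/-- The step functions interpolating implicit Euler polygons with step `1 / (n + 1)` have limits
that solve the differential inclusion. -/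
theorem exists_curve_of_euler_polygons {F : E → Set E} (hconv : ∀ x, Convex ℝ (F x))
    (hclosed : ∀ x, IsClosed (F x))
    (husc : ∀ x, ∀ ε > 0, ∀ᶠ y in 𝓝 x, F y ⊆ Metric.cthickening ε (F x)) {x₀ : E}
    {X : ℕ → ℕ → E} (hX₀ : ∀ n, X n 0 = x₀)
    (hstep : ∀ n k, ∃ g ∈ F (X n (k + 1)), X n (k + 1) - X n k = -((1 / (n + 1 : ℝ)) • g))
    (hbound : ∀ K : ℝ, 0 ≤ K → ∃ R M : ℝ, 0 ≤ M ∧ ∀ n m : ℕ, (m : ℝ) ≤ K * (n + 1) →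
      X n m ∈ Metric.closedBall x₀ R ∧ ∀ g ∈ F (X n m), ‖g‖ ≤ M) :
    ∃ x : ℝ → E, x 0 = x₀ ∧ (∀ K : ℝ, 0 ≤ K → ∃ M : NNReal, LipschitzOnWith M x (Iic K)) ∧
      ∀ t, 0 ≤ t → ∀ d, HasDerivAt x d t → -d ∈ F (x t) := by
  -- Index of the step reached at time `t`. It is `0` for negative `t`, so the limit curve is
  -- constant there and the Lipschitz bounds hold on all of `Iic K`.
  set ν : ℕ → ℝ → ℕ := fun n t => ⌊t * (n + 1 : ℝ)⌋₊ with hν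
  have hνle : ∀ (n : ℕ) {t K : ℝ}, t ≤ K → 0 ≤ K → (ν n t : ℝ) ≤ K * (n + 1) := by
    intro n t K htK hK
    have hn : (0 : ℝ) ≤ n + 1 := by positivity
    rcases le_total 0 t with ht | ht
    · exact (Nat.floor_le (by positivity)).trans (by gcongr)
    · have : ν n t = 0 := Nat.floor_of_nonpos (mul_nonpos_of_nonpos_of_nonneg ht hn)
      rw [this, Nat.cast_zero]; exact mul_nonneg hK hn
  have hνmono : ∀ n, Monotone (ν n) := fun n s t hst => Nat.floor_mono (by gcongr)
  -- A nonprincipal ultrafilter gives limits at all times simultaneously, in place of a diagonal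
  -- extraction.
  let U : Ultrafilter ℕ := hyperfilter ℕ
  have hU : (U : Filter ℕ) ≤ atTop := by
    rw [← Nat.cofinite_eq_atTop]; exact hyperfilter_le_cofinite
  have hinv : Tendsto (fun n : ℕ => 1 / (n + 1 : ℝ)) U (𝓝 0) :=
    tendsto_one_div_add_atTop_nhds_zero_nat.mono_left hU
  have hex : ∀ t : ℝ, ∃ y, Tendsto (fun n => X n (ν n t)) U (𝓝 y) := by
    intro t
    obtain ⟨R, M, -, h⟩ := hbound (max t 0) (le_max_right _ _)
    obtain ⟨y, -, hy⟩ := (isCompact_closedBall x₀ R).ultrafilter_le_nhds'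
      (U.map fun n => X n (ν n t)) (Ultrafilter.mem_map.2 (univ_mem' fun n =>
        (h n _ (hνle n (le_max_left _ _) (le_max_right _ _))).1))
    exact ⟨y, hy⟩
  choose x hx using hex
  have hincr : ∀ (n : ℕ) {s t : ℝ} {C : Set E}, Convex ℝ C → ν n s < ν n t →
      (∀ m, ν n s < m → m ≤ ν n t → F (X n m) ⊆ C) →
      ∃ g ∈ C, X n (ν n t) - X n (ν n s) =
        -((((ν n t : ℝ) - ν n s) * (1 / (n + 1 : ℝ))) • g) := by
    intro n s t C hC hlt hF
    obtain ⟨j, hj⟩ := Nat.exists_eq_add_of_lt hlt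
    obtain ⟨g, hg, e⟩ := exists_mem_convex_increment (X := X n) (h := 1 / (n + 1 : ℝ)) hC j
      (k := ν n s) fun i hi => by
        obtain ⟨g, hg, e⟩ := hstep n (ν n s + i)
        exact ⟨g, hF _ (by omega) (by omega) hg, e⟩
    refine ⟨g, hg, ?_⟩
    rw [hj, e]
    congr 3
    push_cast; ring
  have hgap : ∀ (n : ℕ) {s t : ℝ}, s ≤ t →
      ((ν n t : ℝ) - ν n s) * (1 / (n + 1 : ℝ)) ≤ t - s + 1 / (n + 1 : ℝ) := by
    intro n s t hst
    have hn : (0 : ℝ) < n + 1 := by positivity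
    rw [mul_one_div, div_le_iff₀ hn, add_mul, one_div, inv_mul_cancel₀ hn.ne', sub_mul]
    have h1 := Nat.lt_floor_add_one (s * (n + 1 : ℝ))
    rcases le_total 0 t with ht | ht
    · have h2 := Nat.floor_le (show 0 ≤ t * (n + 1 : ℝ) by positivity)
      simp only [hν]; linarith
    · have : ν n t = 0 := Nat.floor_of_nonpos (mul_nonpos_of_nonpos_of_nonneg ht hn.le)
      rw [this]
      have : 0 ≤ (t - s) * (n + 1 : ℝ) := mul_nonneg (by linarith) hn.le
      have : (0 : ℝ) ≤ ν n s := by positivity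
      push_cast; linarith
  have hLip : ∀ (K : ℝ), 0 ≤ K → ∃ M : ℝ, 0 ≤ M ∧ ∀ s t : ℝ, s ≤ t → t ≤ K → ∀ n,
      ‖X n (ν n t) - X n (ν n s)‖ ≤ M * (t - s + 1 / (n + 1 : ℝ)) := by
    intro K hK
    obtain ⟨R, M, hM, h⟩ := hbound K hK
    refine ⟨M, hM, fun s t hst htK n => ?_⟩
    have hn : (0 : ℝ) ≤ 1 / (n + 1 : ℝ) := by positivity
    rcases (hνmono n hst).eq_or_lt with e | hlt
    · rw [e, sub_self, norm_zero]
      exact mul_nonneg hM (by linarith)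
    · obtain ⟨g, hg, e⟩ := hincr n (C := Metric.closedBall 0 M) (convex_closedBall _ _) hlt
        fun m _ hm g hg => by
          have : (m : ℝ) ≤ K * (n + 1) := le_trans (by exact_mod_cast hm) (hνle n htK hK)
          simpa using (h n m this).2 g hg
      have hg' : ‖g‖ ≤ M := by simpa using hg
      have h0 : (0 : ℝ) ≤ ((ν n t : ℝ) - ν n s) * (1 / (n + 1 : ℝ)) := by
        have : (ν n s : ℝ) ≤ ν n t := by exact_mod_cast hlt.le
        exact mul_nonneg (by linarith) hn
      rw [e, norm_neg, norm_smul, Real.norm_of_nonneg h0, mul_comm]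
      gcongr
      exact hgap n hst
  have hxLip : ∀ (K : ℝ), 0 ≤ K → ∃ M : ℝ, 0 ≤ M ∧ ∀ s t : ℝ, s ≤ t → t ≤ K →
      ‖x t - x s‖ ≤ M * (t - s) := by
    intro K hK
    obtain ⟨M, hM, h⟩ := hLip K hK
    refine ⟨M, hM, fun s t hst htK => ?_⟩
    have h1 : Tendsto (fun n : ℕ => M * (t - s + 1 / (n + 1 : ℝ))) U (𝓝 (M * (t - s + 0))) :=
      (hinv.const_add _).const_mul _
    rw [add_zero] at h1
    exact le_of_tendsto_of_tendsto ((hx t).sub (hx s)).norm h1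
      (Eventually.of_forall fun n => h s t hst htK n)
  refine ⟨x, ?_, fun K hK => ?_, fun t ht d hd => ?_⟩
  · refine tendsto_nhds_unique (hx 0) ?_
    simp [hν, hX₀]
  · obtain ⟨M, hM, h⟩ := hxLip K hK
    refine ⟨M.toNNReal, LipschitzOnWith.of_dist_le_mul fun s hs t ht => ?_⟩
    rw [Real.coe_toNNReal _ hM]
    rcases le_total s t with hst | hst
    · rw [dist_comm, dist_comm s, dist_eq_norm, Real.dist_eq, abs_of_nonneg (by linarith)]
      exact h s t hst ht
    · rw [dist_eq_norm, Real.dist_eq, abs_of_nonneg (by linarith)]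
      exact h t s hst hs
  · rw [← (hclosed (x t)).closure_eq, Metric.closure_eq_iInter_cthickening]
    refine mem_iInter₂.2 fun ε hε => ?_
    set C := Metric.cthickening ε (F (x t))
    have hCconv : Convex ℝ C := (hconv _).cthickening ε
    have hCclosed : IsClosed C := Metric.isClosed_cthickening
    obtain ⟨δ, hδ, hball⟩ := Metric.eventually_nhds_iff.1 (husc (x t) ε hε)
    obtain ⟨M, hM, hL⟩ := hLip (t + 1) (by linarith)
    have hslope : Tendsto (fun s => -slope x t s) (𝓝[>] t) (𝓝 (-d)) :=
      ((hasDerivAt_iff_tendsto_slope.1 hd).mono_left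
        (nhdsWithin_mono _ fun z (hz : t < z) => hz.ne')).neg
    refine hCclosed.mem_of_tendsto hslope ?_
    have hnear : ∀ᶠ s in 𝓝[>] t, s ≤ t + 1 ∧ M * (s - t) < δ / 2 := by
      refine (eventually_nhdsWithin_of_eventually_nhds ?_)
      refine (ge_mem_nhds (by linarith)).and ?_
      have : Continuous fun s => M * (s - t) := by fun_prop
      exact (this.tendsto t).eventually (gt_mem_nhds (by simpa using half_pos hδ))
    filter_upwards [hnear, self_mem_nhdsWithin] with s ⟨hs1, hsδ⟩ hts
    replace hts : t < s := hts
    have hcoef : Tendsto (fun n : ℕ => ((ν n s : ℝ) - ν n t) * (1 / (n + 1 : ℝ))) U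
        (𝓝 (s - t)) := by
      have hn : Tendsto (fun n : ℕ => (n + 1 : ℝ)) atTop atTop :=
        tendsto_natCast_atTop_atTop.atTop_add tendsto_const_nhds
      have h1 := (tendsto_nat_floor_mul_div_atTop (ht.trans hts.le)).comp hn
      have h2 := (tendsto_nat_floor_mul_div_atTop ht).comp hn
      refine ((h1.sub h2).mono_left hU).congr fun n => ?_
      simp only [hν, Function.comp]
      ring
    have hquot : Tendsto (fun n : ℕ => -((((ν n s : ℝ) - ν n t) * (1 / (n + 1 : ℝ)))⁻¹ •
        (X n (ν n s) - X n (ν n t)))) U (𝓝 (-slope x t s)) := by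
      rw [slope_def_module]
      exact ((hcoef.inv₀ (by linarith)).smul ((hx s).sub (hx t))).neg
    refine hCclosed.mem_of_tendsto hquot ?_
    have e1 : ∀ᶠ n in (U : Filter ℕ), dist (X n (ν n t)) (x t) < δ / 4 :=
      (hx t).eventually (Metric.ball_mem_nhds _ (by linarith))
    have e2 : ∀ᶠ n : ℕ in (U : Filter ℕ), M * (1 / (n + 1 : ℝ)) < δ / 4 := by
      have := hinv.const_mul M
      rw [mul_zero] at this
      exact this.eventually (gt_mem_nhds (by linarith))
    have e3 := hcoef.eventually (lt_mem_nhds (show 0 < s - t by linarith))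
    filter_upwards [e1, e2, e3] with n h1 h2 h3
    have hn : (0 : ℝ) < n + 1 := by positivity
    have hlt : ν n t < ν n s := by
      have := pos_of_mul_pos_left h3 (by positivity)
      exact_mod_cast sub_pos.1 this
    -- Every step index involved corresponds to a time `m / (n + 1)` in `[t, s]`, so `X n m` is
    -- within `δ` of `x t` and its velocity lies in `C`.
    obtain ⟨g, hg, e⟩ := hincr n hCconv hlt fun m hm1 hm2 => by
      refine hball ?_
      have hm : ν n (m / (n + 1 : ℝ)) = m := by
        simp only [hν]
        rw [div_mul_cancel₀ _ hn.ne', Nat.floor_natCast]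
      have hms : (m / (n + 1 : ℝ)) ≤ s := by
        rw [div_le_iff₀ hn]
        exact (Nat.cast_le.2 hm2).trans (hνle n le_rfl (ht.trans hts.le))
      have hmt : t ≤ m / (n + 1 : ℝ) := by
        rw [le_div_iff₀ hn]
        exact (Nat.lt_of_floor_lt hm1).le
      have h4 := hL t _ hmt (hms.trans hs1) n
      rw [hm] at h4
      have h5 : M * (m / (n + 1 : ℝ) - t + 1 / (n + 1 : ℝ)) ≤
          M * (s - t) + M * (1 / (n + 1 : ℝ)) := by
        rw [← mul_add]; gcongr
      calc dist (X n m) (x t) ≤ dist (X n m) (X n (ν n t)) + dist (X n (ν n t)) (x t) :=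
            dist_triangle _ _ _
        _ < δ := by rw [dist_eq_norm (X n m)]; linarith
    rw [e, smul_neg, neg_neg, smul_smul, inv_mul_cancel₀ h3.ne', one_smul]
    exact hg

variable {f : E → ℝ} {p : κ → E → ℝ}

/-- One step of the implicit Euler scheme, as a proximal minimization. -/
theorem IsPiecewiseSmooth.exists_implicit_step [Finite κ] (h : IsPiecewiseSmooth f p)
    (hf : ∀ x, 0 ≤ f x) {τ : ℝ} (hτ : 0 < τ) (x : E) :
    ∃ y, (∃ g ∈ activeHull f p y, y - x = -(τ • g)) ∧ f y + ‖y - x‖ ^ 2 / (2 * τ) ≤ f x := by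
  have hcont : Continuous fun y => f y + ‖y - x‖ ^ 2 / (2 * τ) := by
    have := h.continuous
    fun_prop
  have hcoer : Tendsto (fun y => f y + ‖y - x‖ ^ 2 / (2 * τ)) (cocompact E) atTop := by
    refine tendsto_atTop_mono (fun y => le_add_of_nonneg_left (hf y)) ?_
    refine Tendsto.atTop_div_const (by positivity) ?_
    refine (tendsto_pow_atTop two_ne_zero).comp ?_
    refine tendsto_atTop_mono (fun y => norm_sub_norm_le y x) ?_
    exact tendsto_atTop_add_const_right _ _ tendsto_norm_cocompact_atTop
  obtain ⟨y, hy⟩ := hcont.exists_forall_le hcoer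
  refine ⟨y, ⟨-(τ⁻¹ • (y - x)), h.mem_activeHull fun d ε hε => ?_, ?_⟩, by simpa using hy x⟩
  · have hc : Continuous fun t : ℝ => t * ‖d‖ ^ 2 / (2 * τ) := by fun_prop
    have := (hc.tendsto 0).eventually (gt_mem_nhds (show 0 * ‖d‖ ^ 2 / (2 * τ) < ε by simpa))
    filter_upwards [eventually_nhdsWithin_of_eventually_nhds this, self_mem_nhdsWithin] with t h1 h2
    replace h2 : 0 < t := h2
    have h3 := hy (y + t • d)
    have h4 : ‖y + t • d - x‖ ^ 2 = ‖y - x‖ ^ 2 + 2 * (t * inner ℝ (y - x) d) + t ^ 2 * ‖d‖ ^ 2 := by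
      rw [show y + t • d - x = (y - x) + t • d by abel, norm_add_sq_real, inner_smul_right,
        norm_smul, mul_pow, Real.norm_eq_abs, sq_abs]
    rw [h4] at h3
    rw [inner_neg_left, inner_smul_left]
    have h5 : (‖y - x‖ ^ 2 + 2 * (t * inner ℝ (y - x) d) + t ^ 2 * ‖d‖ ^ 2) / (2 * τ) =
        ‖y - x‖ ^ 2 / (2 * τ) + t * (τ⁻¹ * inner ℝ (y - x) d) + t * (t * ‖d‖ ^ 2 / (2 * τ)) := by
      field_simp
    rw [h5] at h3
    have h6 := mul_lt_mul_of_pos_left h1 h2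
    simp only [conj_trivial]
    nlinarith
  · rw [smul_neg, neg_neg, smul_smul, mul_inv_cancel₀ hτ.ne', one_smul]

theorem IsPiecewiseSmooth.exists_curve [Finite κ] (h : IsPiecewiseSmooth f p)
    (hf : ∀ x, 0 ≤ f x) (x₀ : E) :
    ∃ x : ℝ → E, x 0 = x₀ ∧ (∀ K : ℝ, 0 ≤ K → ∃ M : NNReal, LipschitzOnWith M x (Iic K)) ∧
      ∀ t, 0 ≤ t → ∀ d, HasDerivAt x d t → -d ∈ activeHull f p (x t) := by
  choose step hstep hdecr using fun n : ℕ => h.exists_implicit_step hf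
    (show 0 < 1 / (n + 1 : ℝ) by positivity)
  let X : ℕ → ℕ → E := fun n k => (step n)^[k] x₀
  have hXs : ∀ n k, X n (k + 1) = step n (X n k) := fun n k => Function.iterate_succ_apply' _ _ _
  -- The proximal decrease is summed using `r ≤ r ^ 2 / (2 * τ) + τ / 2` for each step length `r`.
  -- For `m * τ ≤ K` the iterates stay in the ball of radius `f x₀ + K / 2`.
  have hdist : ∀ n m : ℕ, ‖X n m - x₀‖ + f (X n m) ≤ f x₀ + m * (1 / (n + 1 : ℝ)) / 2 := by
    intro n m
    induction m with
    | zero => simp [X]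
    | succ m ih =>
      rw [hXs]
      set y := X n m
      have h1 := hdecr n y
      have hn : (0 : ℝ) < 1 / (n + 1 : ℝ) := by positivity
      set τ := 1 / (n + 1 : ℝ)
      have h2 : ‖step n y - x₀‖ ≤ ‖step n y - y‖ + ‖y - x₀‖ := by
        simpa using norm_add_le (step n y - y) (y - x₀)
      have h3 : ‖step n y - y‖ ≤ ‖step n y - y‖ ^ 2 / (2 * τ) + τ / 2 := by
        rw [div_add_div _ _ (by positivity) two_ne_zero, le_div_iff₀ (by positivity)]
        nlinarith [sq_nonneg (‖step n y - y‖ - τ)]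
      push_cast
      linarith
  refine exists_curve_of_euler_polygons (X := X) convex_activeHull
    (fun x => (isCompact_activeHull x).isClosed)
    (fun x ε hε => h.eventually_activeHull_subset_cthickening x hε) (fun n => rfl)
    (fun n k => by rw [hXs]; exact hstep n _) fun K hK => ?_
  obtain ⟨M, hM, hMb⟩ := h.exists_norm_le x₀ (f x₀ + K / 2)
  refine ⟨f x₀ + K / 2, M, hM, fun n m hm => ?_⟩
  have hmem : X n m ∈ Metric.closedBall x₀ (f x₀ + K / 2) := by
    rw [mem_closedBall_iff_norm]
    have h1 := hdist n m
    have h2 := hf (X n m)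
    have h3 : m * (1 / (n + 1 : ℝ)) ≤ K := by
      rw [mul_one_div, div_le_iff₀ (by positivity)]; exact hm
    linarith
  exact ⟨hmem, hMb _ hmem⟩

end Existence

/-! ### Absolute continuity, exceptional zeros and Grönwall's inequality -/

theorem absolutelyContinuousOnInterval_of_dist_le {X Y : Type*} [PseudoMetricSpace X]
    [PseudoMetricSpace Y] {F : ℝ → X} {g : ℝ → Y} {a b C : ℝ}
    (hg : AbsolutelyContinuousOnInterval g a b)
    (h : ∀ x ∈ uIcc a b, ∀ y ∈ uIcc a b, dist (F x) (F y) ≤ C * dist (g x) (g y)) :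
    AbsolutelyContinuousOnInterval F a b := by
  have hg' : Tendsto (fun E : ℕ × (ℕ → ℝ × ℝ) =>
      C * ∑ i ∈ Finset.range E.1, dist (g (E.2 i).1) (g (E.2 i).2))
      (AbsolutelyContinuousOnInterval.totalLengthFilter ⊓
        𝓟 (AbsolutelyContinuousOnInterval.disjWithin a b)) (𝓝 0) := by
    simpa using Tendsto.const_mul C hg
  refine squeeze_zero' (Eventually.of_forall fun E => by positivity) ?_ hg'
  refine mem_inf_of_right (mem_principal.2 fun E hE => ?_)
  simp only [mem_ofPred_eq, Finset.mul_sum]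
  exact Finset.sum_le_sum fun i hi => h _ (hE.1 i hi).1 _ (hE.1 i hi).2

/-- The zeros of a function at which it has a nonzero derivative form a countable set. -/
theorem countable_zeros_of_deriv_ne_zero (u : ℝ → ℝ) :
    {t | u t = 0 ∧ ∃ d, d ≠ 0 ∧ HasDerivAt u d t}.Countable := by
  -- A zero with nonzero derivative is isolated among all zeros; a discrete subset of the line is
  -- countable.
  have : DiscreteTopology {t | u t = 0 ∧ ∃ d, d ≠ 0 ∧ HasDerivAt u d t} := by
    refine discreteTopology_subtype_iff.2 fun t ht => ?_
    obtain ⟨-, d, hd, hu⟩ := ht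
    rw [← disjoint_iff, disjoint_principal_right]
    filter_upwards [hu.eventually_ne (c := 0) hd] with s hs hs'
    exact hs hs'.1
  exact countable_coe_iff.1 (countable_of_Lindelof_of_discrete)

/-- Grönwall's inequality for absolutely continuous functions. -/
theorem le_mul_exp_of_ae_deriv_le {φ a : ℝ → ℝ} {t : ℝ} (ht : 0 ≤ t)
    (hφ : AbsolutelyContinuousOnInterval φ 0 t) (ha : ContinuousOn a (Icc 0 t))
    (h : ∀ᵐ s, s ∈ Icc 0 t → ∃ d, HasDerivAt φ d s ∧ d ≤ -(2 * a s * φ s)) :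
    φ t ≤ φ 0 * Real.exp (-2 * ∫ s in (0 : ℝ)..t, a s) := by
  have hint : IntervalIntegrable a volume 0 t := ContinuousOn.intervalIntegrable (by rwa [uIcc_of_le ht])
  set A : ℝ → ℝ := fun s => ∫ r in (0 : ℝ)..s, a r with hA
  have hAac : AbsolutelyContinuousOnInterval A 0 t :=
    hint.absolutelyContinuousOnInterval_intervalIntegral left_mem_uIcc
  have hexp : AbsolutelyContinuousOnInterval (fun s => Real.exp (2 * A s)) 0 t := by
    have hlip : LocallyLipschitz fun y : ℝ => Real.exp (2 * y) :=
      ContDiff.locallyLipschitz (𝕂 := ℝ) (by fun_prop)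
    obtain ⟨C, hC⟩ := (hlip.locallyLipschitzOn (s := A '' uIcc 0 t)).exists_lipschitzOnWith_of_compact
      (isCompact_uIcc.image_of_continuousOn hAac.continuousOn)
    exact absolutelyContinuousOnInterval_of_dist_le hAac fun x hx y hy =>
      hC.dist_le_mul _ ⟨x, hx, rfl⟩ _ ⟨y, hy, rfl⟩
  have hψ := hφ.fun_mul hexp
  -- The integrating factor `exp (2 * A)` makes the derivative of the product nonpositive almost
  -- everywhere; absolute continuity permits integrating it.
  have hle : ∫ s in (0 : ℝ)..t, deriv (fun s => φ s * Real.exp (2 * A s)) s ≤ 0 := by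
    rw [intervalIntegral.integral_of_le ht, ← neg_nonneg, ← integral_neg]
    refine setIntegral_nonneg_of_ae_restrict ?_
    rw [EventuallyLE, ae_restrict_iff' measurableSet_Ioc]
    filter_upwards [h, hint.ae_hasDerivAt_integral] with s hs hs' hst
    obtain ⟨d, hd, hle⟩ := hs (Ioc_subset_Icc_self hst)
    have hAs : HasDerivAt A (a s) s := hs' (by rw [uIcc_of_le ht]; exact Ioc_subset_Icc_self hst) 0
      left_mem_uIcc
    rw [(hd.fun_mul (hAs.const_mul 2).exp).deriv]
    have := Real.exp_pos (2 * A s)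
    simp only [Pi.zero_apply]
    nlinarith
  rw [hψ.integral_deriv_eq_sub] at hle
  have hA0 : A 0 = 0 := by simp [hA]
  rw [hA0, mul_zero, Real.exp_zero, mul_one] at hle
  have e : Real.exp (2 * A t) * Real.exp (-2 * A t) = 1 := by rw [← Real.exp_add]; simp
  calc φ t = φ t * Real.exp (2 * A t) * Real.exp (-2 * A t) := by rw [mul_assoc, e, mul_one]
    _ ≤ φ 0 * Real.exp (-2 * A t) := by gcongr; linarith

/-! ### Curves as integrals of their velocity -/

section Arc

variable {E κ : Type*} [NormedAddCommGroup E] [InnerProductSpace ℝ E] [FiniteDimensional ℝ E]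

/-- A locally Lipschitz curve is the integral of its derivative. -/
theorem sub_eq_integral_deriv {x : ℝ → E} {M : NNReal} {t : ℝ} (ht : 0 ≤ t)
    (hx : LipschitzOnWith M x (Iic (t + 1))) :
    IntervalIntegrable (deriv x) volume 0 t ∧ x t - x 0 = ∫ s in (0 : ℝ)..t, deriv x s := by
  have hbound : ∀ s ∈ uIcc 0 t, ‖deriv x s‖ ≤ M := fun s hs =>
    norm_deriv_le_of_lipschitzOn (Iic_mem_nhds (by rw [uIcc_of_le ht] at hs; linarith [hs.2])) hx
  have hint : IntervalIntegrable (deriv x) volume 0 t := by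
    refine (intervalIntegrable_const (c := (M : ℝ))).mono_fun
      (stronglyMeasurable_deriv x).aestronglyMeasurable ?_
    rw [EventuallyLE, ae_restrict_iff' measurableSet_uIoc]
    refine ae_of_all _ fun s hs => ?_
    simpa using hbound s (uIoc_subset_uIcc hs)
  refine ⟨hint, ?_⟩
  have hsub : ∀ {s}, s ∈ uIcc 0 t → IntervalIntegrable (deriv x) volume 0 s := fun hs =>
    hint.mono_set (uIcc_subset_uIcc_left hs)
  have hxac : AbsolutelyContinuousOnInterval x 0 t :=
    (hx.mono fun s hs => by
      rw [uIcc_of_le ht] at hs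
      exact hs.2.trans (by linarith)).absolutelyContinuousOnInterval
  have hIac : AbsolutelyContinuousOnInterval (fun s => ∫ r in (0 : ℝ)..s, deriv x r) 0 t := by
    refine LipschitzOnWith.absolutelyContinuousOnInterval (K := M)
      (LipschitzOnWith.of_dist_le_mul fun a ha b hb => ?_)
    rw [dist_eq_norm, intervalIntegral.integral_interval_sub_left (hsub ha) (hsub hb),
      Real.dist_eq]
    refine intervalIntegral.norm_integral_le_of_norm_le_const fun s hs => ?_
    exact hbound s (uIcc_subset_uIcc hb ha (uIoc_subset_uIcc hs))
  obtain ⟨c, hc⟩ := (hxac.fun_sub hIac).const_of_ae_hasDerivAt_zero (by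
    filter_upwards [hx.ae_differentiableWithinAt_of_mem, hint.ae_hasDerivAt_integral] with s h1 h2 hs
    have hst : s ≤ t := by rw [uIcc_of_le ht] at hs; exact hs.2
    have h3 := (h1 (show s ≤ t + 1 by linarith)).differentiableAt (Iic_mem_nhds (by linarith))
    simpa using h3.hasDerivAt.fun_sub (h2 hs 0 left_mem_uIcc))
  have h0 := hc 0 left_mem_uIcc
  have h1 := hc t right_mem_uIcc
  simp only [intervalIntegral.integral_same, sub_zero] at h0
  rw [h0, ← h1]; abel

variable {f : E → ℝ} {p : κ → E → ℝ}

theorem IsPiecewiseSmooth.exists_lipschitz_closedBall [Finite κ] (h : IsPiecewiseSmooth f p)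
    (x : E) (R : ℝ) : ∃ M : ℝ, 0 ≤ M ∧ ∀ y ∈ Metric.closedBall x R, ∀ z ∈ Metric.closedBall x R,
      dist (f y) (f z) ≤ M * dist y z := by
  obtain ⟨M, hM, hb⟩ := h.exists_norm_le x R
  have key : ∀ y ∈ Metric.closedBall x R, ∀ z ∈ Metric.closedBall x R,
      f z ≤ f y + M * dist y z := by
    intro y hy z hz
    have := h.line_le (x := y) (d := z - y) (c := M * ‖z - y‖) zero_le_one fun t ht S hS => by
      refine (real_inner_le_norm _ _).trans ?_
      gcongr
      refine hb _ ?_ _ (subset_convexHull ℝ _ ⟨S, hS, rfl⟩)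
      exact (convex_closedBall x R).add_smul_sub_mem hy hz ⟨ht.1, ht.2.le⟩
    simpa [dist_comm y z, dist_eq_norm] using this
  refine ⟨M, hM, fun y hy z hz => ?_⟩
  rw [Real.dist_eq, abs_sub_le_iff]
  have h1 := key y hy z hz
  have h2 := key z hz y hy
  rw [dist_comm z y] at h2
  constructor <;> linarith

theorem continuousOn_of_sub_eq_integral {x v : ℝ → E} {t : ℝ} (ht : 0 ≤ t)
    (hv : IntervalIntegrable v volume 0 t)
    (hx : ∀ s ∈ Icc 0 t, x s - x 0 = ∫ r in (0 : ℝ)..s, v r) : ContinuousOn x (Icc 0 t) := by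
  have h1 : ContinuousOn (fun s => x 0 + ∫ r in (0 : ℝ)..s, v r) (Icc 0 t) := by
    refine continuousOn_const.add ?_
    have := intervalIntegral.continuousOn_primitive_interval' hv left_mem_uIcc
    rwa [uIcc_of_le ht] at this
  exact h1.congr fun s hs => by simp [← hx s hs]

/-- The arc stays in a ball on which `f` is Lipschitz, so increments of `f ∘ x` are dominated by
those of the arc length `∫ ‖v‖`. -/
theorem IsPiecewiseSmooth.absolutelyContinuousOnInterval_comp [Finite κ]
    (h : IsPiecewiseSmooth f p) {x v : ℝ → E} {t : ℝ} (ht : 0 ≤ t)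
    (hv : IntervalIntegrable v volume 0 t)
    (hx : ∀ s ∈ Icc 0 t, x s - x 0 = ∫ r in (0 : ℝ)..s, v r) :
    AbsolutelyContinuousOnInterval (fun s => f (x s)) 0 t := by
  have hcont := continuousOn_of_sub_eq_integral ht hv hx
  obtain ⟨R, hR⟩ := (isCompact_Icc.image_of_continuousOn hcont).isBounded.subset_closedBall 0
  obtain ⟨M, hM, hlip⟩ := h.exists_lipschitz_closedBall 0 R
  have hV : AbsolutelyContinuousOnInterval (fun s => ∫ r in (0 : ℝ)..s, ‖v r‖) 0 t :=
    hv.norm.absolutelyContinuousOnInterval_intervalIntegral left_mem_uIcc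
  refine absolutelyContinuousOnInterval_of_dist_le (C := M) hV fun a ha b hb => ?_
  have hva := hv.mono_set (uIcc_subset_uIcc_left ha)
  have hvb := hv.mono_set (uIcc_subset_uIcc_left hb)
  rw [uIcc_of_le ht] at ha hb
  refine (hlip _ (hR ⟨a, ha, rfl⟩) _ (hR ⟨b, hb, rfl⟩)).trans ?_
  gcongr
  rw [dist_eq_norm, Real.dist_eq, intervalIntegral.integral_interval_sub_left hva.norm hvb.norm,
    ← sub_sub_sub_cancel_right (x a) (x b) (x 0), hx a ha, hx b hb,
    intervalIntegral.integral_interval_sub_left hva hvb]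
  exact intervalIntegral.norm_integral_le_abs_integral_norm

end Arc

/-! ### Energy identity and extension of solutions -/

section Solution

variable {ι κ : Type*} [Fintype ι] [Finite κ] {f : EuclideanSpace ℝ ι → ℝ}
  {p : κ → EuclideanSpace ℝ ι → ℝ} {x₀ : EuclideanSpace ℝ ι} {T : EReal}
  {θ : ℝ → EuclideanSpace ℝ ι}

theorem IsPiecewiseSmooth.exists_isSolution_top (h : IsPiecewiseSmooth f p) (hf : ∀ x, 0 ≤ f x)
    (x₀ : EuclideanSpace ℝ ι) : ∃ θ, IsSolution f x₀ ⊤ θ := by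
  obtain ⟨x, hx0, hlip, hd⟩ := h.exists_curve hf x₀
  refine ⟨x, hx0, ⟨deriv x, fun t ht _ => ?_⟩, ?_⟩
  · obtain ⟨M, hM⟩ := hlip (t + 1) (by linarith)
    exact sub_eq_integral_deriv ht hM
  · have hdiff : ∀ n : ℕ, ∀ᵐ t : ℝ, t < n → DifferentiableAt ℝ x t := by
      intro n
      obtain ⟨M, hM⟩ := hlip n n.cast_nonneg
      filter_upwards [hM.ae_differentiableWithinAt_of_mem] with t ht htn
      exact (ht htn.le).differentiableAt (Iic_mem_nhds htn)
    filter_upwards [ae_all_iff.2 hdiff] with t ht ht0 _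
    obtain ⟨n, hn⟩ := exists_nat_gt t
    refine ⟨_, (ht n hn).hasDerivAt, ?_⟩
    rw [h.clarkeSubdifferential_eq]
    exact hd t ht0 _ (ht n hn).hasDerivAt

theorem IsArc.exists_velocity {x : ℝ → EuclideanSpace ℝ ι} (hx : IsArc T x) :
    ∃ v : ℝ → EuclideanSpace ℝ ι, ∀ t : ℝ, 0 ≤ t → (t : EReal) < T →
      IntervalIntegrable v volume 0 t ∧ ∀ s ∈ Icc 0 t, x s - x 0 = ∫ r in (0 : ℝ)..s, v r := by
  obtain ⟨v, hv⟩ := hx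
  exact ⟨v, fun t ht htT => ⟨(hv t ht htT).1, fun s hs =>
    (hv s hs.1 ((EReal.coe_le_coe_iff.2 hs.2).trans_lt htT)).2⟩⟩

theorem IsArc.continuousOn {x : ℝ → EuclideanSpace ℝ ι} (hx : IsArc T x) {t : ℝ} (ht : 0 ≤ t)
    (htT : (t : EReal) < T) : ContinuousOn x (Icc 0 t) := by
  obtain ⟨v, hv⟩ := hx.exists_velocity
  exact continuousOn_of_sub_eq_integral ht (hv t ht htT).1 (hv t ht htT).2

theorem IsPiecewiseSmooth.absolutelyContinuousOnInterval_arc (h : IsPiecewiseSmooth f p)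
    {x : ℝ → EuclideanSpace ℝ ι} (hx : IsArc T x) {t : ℝ} (ht : 0 ≤ t) (htT : (t : EReal) < T) :
    AbsolutelyContinuousOnInterval (fun s => f (x s)) 0 t := by
  obtain ⟨v, hv⟩ := hx.exists_velocity
  exact h.absolutelyContinuousOnInterval_comp ht (hv t ht htT).1 (hv t ht htT).2

/-- Along a solution the function decreases at the rate of the squared speed. -/
theorem IsPiecewiseSmooth.ae_hasDerivAt_comp (h : IsPiecewiseSmooth f p)
    (hθ : IsSolution f x₀ T θ) {t : ℝ} (ht : 0 ≤ t) (htT : (t : EReal) < T) :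
    ∀ᵐ s, s ∈ Icc 0 t → ∃ d, HasDerivAt θ d s ∧ -d ∈ activeHull f p (θ s) ∧
      HasDerivAt (fun r => f (θ r)) (-‖d‖ ^ 2) s := by
  have hz : ∀ S, ∀ᵐ s : ℝ, s ∉ {s | f (θ s) - p S (θ s) = 0 ∧
      ∃ d, d ≠ 0 ∧ HasDerivAt (fun s => f (θ s) - p S (θ s)) d s} := fun S =>
    (countable_zeros_of_deriv_ne_zero _).ae_notMem volume
  have hdiff := (h.absolutelyContinuousOnInterval_arc hθ.arc ht htT).ae_differentiableAt
  rw [uIcc_of_le ht] at hdiff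
  filter_upwards [hdiff, hθ.inclusion, ae_all_iff.2 hz] with s h1 h2 h3 hs
  obtain ⟨d, hd, hmem⟩ := h2 hs.1 ((EReal.coe_le_coe_iff.2 hs.2).trans_lt htT)
  rw [h.clarkeSubdifferential_eq] at hmem
  refine ⟨d, hd, hmem, ?_⟩
  have hD := (h1 hs).hasDerivAt
  set D := deriv (fun r => f (θ r)) s
  -- If an active piece had another derivative along `θ` than `f`, then `s` would be one of the
  -- exceptional zeros excluded by `h3`.
  have hall : activeHull f p (θ s) ⊆ {g | inner ℝ g d = D} := by
    refine convexHull_min ?_ ?_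
    · rintro _ ⟨S, hS, rfl⟩
      by_contra hne
      refine h3 S ⟨sub_eq_zero.2 (h.eq_of_mem_activePieces hS), D - inner ℝ (gradient (p S) (θ s)) d,
        sub_ne_zero.2 fun e => hne e.symm, ?_⟩
      exact hD.sub ((h.hasGradientAt S (θ s)).comp_hasDerivAt hd)
    · intro g hg g' hg' a b _ _ hab
      simp only [mem_ofPred_eq] at hg hg' ⊢
      rw [inner_add_left, inner_smul_left, inner_smul_left, hg, hg', ← add_mul]
      simp [hab]
  have e : inner ℝ (-d) d = D := hall hmem
  rw [inner_neg_left, real_inner_self_eq_norm_sq] at e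
  rwa [e]

/-- The length of a solution is controlled by the elapsed time and the initial value. -/
theorem IsPiecewiseSmooth.integral_norm_velocity_le (h : IsPiecewiseSmooth f p)
    (hf : ∀ x, 0 ≤ f x) (hθ : IsSolution f x₀ T θ) {t : ℝ} (ht : 0 ≤ t) (htT : (t : EReal) < T)
    {v : ℝ → EuclideanSpace ℝ ι} (hv : IntervalIntegrable v volume 0 t)
    (hx : ∀ s ∈ Icc 0 t, θ s - θ 0 = ∫ r in (0 : ℝ)..s, v r) :
    ∫ s in (0 : ℝ)..t, ‖v s‖ ≤ (t + f x₀) / 2 := by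
  have hac := h.absolutelyContinuousOnInterval_arc hθ.arc ht htT
  have hle : ∫ s in (0 : ℝ)..t, ‖v s‖ ≤
      ∫ s in (0 : ℝ)..t, (1 - deriv (fun r => f (θ r)) s) * (1 / 2) := by
    refine intervalIntegral.integral_mono_ae_restrict ht hv.norm
      ((intervalIntegrable_const.sub hac.intervalIntegrable_deriv).mul_const _) ?_
    have hne : ∀ c : ℝ, ∀ᵐ s : ℝ, s ≠ c := fun c => by simp [ae_iff, measure_singleton]
    rw [EventuallyLE, ae_restrict_iff' measurableSet_Icc]
    filter_upwards [h.ae_hasDerivAt_comp hθ ht htT, hv.ae_hasDerivAt_integral, hne 0, hne t]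
      with s h1 h2 hs0 hst hs
    obtain ⟨d, hd, -, hD⟩ := h1 hs
    have hs' : s ∈ Ioo 0 t := ⟨lt_of_le_of_ne hs.1 hs0.symm, lt_of_le_of_ne hs.2 hst⟩
    have e : v s = d := by
      have h3 := (h2 (by rwa [uIcc_of_le ht]) 0 left_mem_uIcc).const_add (θ 0)
      refine h3.unique (hd.congr_of_eventuallyEq ?_)
      filter_upwards [Ioo_mem_nhds hs'.1 hs'.2] with r hr
      rw [← hx r (Ioo_subset_Icc_self hr)]; abel
    rw [hD.deriv, e]
    nlinarith [sq_nonneg (‖d‖ - 1)]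
  refine hle.trans ?_
  rw [intervalIntegral.integral_mul_const, intervalIntegral.integral_sub intervalIntegrable_const
    hac.intervalIntegrable_deriv, hac.integral_deriv_eq_sub, hθ.initial]
  simp only [intervalIntegral.integral_const, sub_zero, smul_eq_mul, mul_one]
  linarith [hf (θ t)]

/-- Solutions do not blow up in finite time, hence extend to all times. -/
theorem IsPiecewiseSmooth.exists_extension_top (h : IsPiecewiseSmooth f p)
    (hf : ∀ x, 0 ≤ f x) (hT : 0 < T) (hθ : IsSolution f x₀ T θ) :
    ∃ θ', IsSolution f x₀ ⊤ θ' ∧ ∀ t : ℝ, 0 ≤ t → (t : EReal) < T → θ' t = θ t := by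
  induction T with
  | bot => exact absurd hT (by simp)
  | top => exact ⟨θ, hθ, fun _ _ _ => rfl⟩
  | coe b =>
  have hb : 0 < b := by exact_mod_cast hT
  obtain ⟨v, hv⟩ := hθ.arc.exists_velocity
  have hvb : IntervalIntegrable v volume 0 b := by
    rw [intervalIntegrable_iff_integrableOn_Ioc_of_le hb.le]
    let c : ℕ → ℝ := fun n => b - b / (n + 1 : ℝ)
    have hc0 : ∀ n, 0 ≤ c n := fun n => sub_nonneg.2 (div_le_self hb.le (by simp))
    have hcb : ∀ n, c n < b := fun n => sub_lt_self _ (by positivity)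
    have hc : Tendsto c atTop (𝓝 b) := by
      have := (tendsto_one_div_add_atTop_nhds_zero_nat (𝕜 := ℝ)).const_mul b |>.const_sub b
      simpa [c, div_eq_mul_inv] using this
    refine integrableOn_Ioc_of_intervalIntegral_norm_bounded_right (I := (b + f x₀) / 2)
      (fun n => (hv (c n) (hc0 n) (EReal.coe_lt_coe_iff.2 (hcb n))).1.1) hc
      (Eventually.of_forall fun n => ?_)
    have h1 := hv (c n) (hc0 n) (EReal.coe_lt_coe_iff.2 (hcb n))
    rw [← intervalIntegral.integral_of_le (hc0 n)]
    refine (h.integral_norm_velocity_le hf hθ (hc0 n) (EReal.coe_lt_coe_iff.2 (hcb n)) h1.1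
      h1.2).trans ?_
    linarith [(hcb n).le]
  -- The starting point is the limit of `θ` at `b`, which exists because the velocity is integrable
  -- up to `b`. The curve `η` is glued there; `b` itself is a null set.
  obtain ⟨η, hη⟩ := h.exists_isSolution_top hf (x₀ + ∫ r in (0 : ℝ)..b, v r)
  obtain ⟨w, hw⟩ := hη.arc
  set θ' : ℝ → EuclideanSpace ℝ ι := fun t => if t < b then θ t else η (t - b) with hθ'
  set v' : ℝ → EuclideanSpace ℝ ι := fun t => if t < b then v t else w (t - b) with hv'
  have hne : ∀ᵐ s : ℝ, s ≠ b := by simp [ae_iff, measure_singleton]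
  have hv'v : ∀ t, t ≤ b → ∀ᵐ s, s ∈ uIoc 0 t → v s = v' s := by
    intro t htb
    filter_upwards [hne] with s hs hst
    have : s ≤ b := hst.2.trans (max_le hb.le htb)
    simp [hv', lt_of_le_of_ne this hs]
  have hleft : ∀ t, 0 ≤ t → t ≤ b → IntervalIntegrable v' volume 0 t ∧
      ∫ s in (0 : ℝ)..t, v' s = ∫ s in (0 : ℝ)..t, v s := by
    intro t ht htb
    have h1 : IntervalIntegrable v volume 0 t := hvb.mono_set
      (uIcc_subset_uIcc_left (by rw [uIcc_of_le hb.le]; exact ⟨ht, htb⟩))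
    exact ⟨h1.congr_ae ((ae_restrict_iff' measurableSet_uIoc).2 (hv'v t htb)),
      (intervalIntegral.integral_congr_ae (hv'v t htb)).symm⟩
  have hright : ∀ t, b ≤ t → IntervalIntegrable v' volume b t ∧
      ∫ s in b..t, v' s = ∫ s in (0 : ℝ)..(t - b), w s := by
    intro t hbt
    have h1 : IntervalIntegrable (fun s => w (s - b)) volume b t := by
      have := (hw (t - b) (sub_nonneg.2 hbt) (EReal.coe_lt_top _)).1.comp_sub_right b
      simpa using this
    have h2 : ∀ s ∈ uIoc b t, w (s - b) = v' s := by
      intro s hs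
      rw [uIoc_of_le hbt] at hs
      simp [hv', hs.1.not_gt]
    refine ⟨h1.congr_ae ((ae_restrict_iff' measurableSet_uIoc).2 (ae_of_all _ h2)), ?_⟩
    rw [← intervalIntegral.integral_congr_ae (ae_of_all _ h2),
      intervalIntegral.integral_comp_sub_right]
    simp
  have h0 : θ' 0 = x₀ := by simp [hθ', hb, hθ.initial]
  refine ⟨θ', ⟨h0, ⟨v', fun t ht _ => ?_⟩, ?_⟩, fun t _ htb => ?_⟩
  · rcases lt_or_ge t b with htb | hbt
    · refine ⟨(hleft t ht htb.le).1, ?_⟩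
      rw [(hleft t ht htb.le).2, h0, ← hθ.initial]
      simpa [hθ', htb] using (hv t ht (EReal.coe_lt_coe_iff.2 htb)).2 t (right_mem_Icc.2 ht)
    · have hl := hleft b hb.le le_rfl
      have hr := hright t hbt
      refine ⟨hl.1.trans hr.1, ?_⟩
      rw [← intervalIntegral.integral_add_adjacent_intervals hl.1 hr.1, hl.2, hr.2,
        ← (hw (t - b) (sub_nonneg.2 hbt) (EReal.coe_lt_top _)).2, hη.initial, h0]
      simp only [hθ', hbt.not_gt, if_false]
      abel
  · have hshift : ∀ᵐ t : ℝ, 0 ≤ t - b → ((t - b : ℝ) : EReal) < ⊤ →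
        ∃ d, HasDerivAt η d (t - b) ∧ -d ∈ clarkeSubdifferential f (η (t - b)) :=
      (measurePreserving_sub_right volume b).quasiMeasurePreserving.ae hη.inclusion
    filter_upwards [hθ.inclusion, hshift, hne] with t h1 h2 htb ht _
    rcases lt_or_gt_of_ne htb with htb | hbt
    · obtain ⟨d, hd, hmem⟩ := h1 ht (EReal.coe_lt_coe_iff.2 htb)
      refine ⟨d, hd.congr_of_eventuallyEq ?_, by simpa [hθ', htb] using hmem⟩
      filter_upwards [Iio_mem_nhds htb] with s hs
      simp [hθ', show s < b from hs]
    · obtain ⟨d, hd, hmem⟩ := h2 (sub_nonneg.2 hbt.le) (EReal.coe_lt_top _)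
      refine ⟨d, (hd.comp_sub_const t b).congr_of_eventuallyEq ?_,
        by simpa [hθ', hbt.not_gt] using hmem⟩
      filter_upwards [Ioi_mem_nhds hbt] with s hs
      simp [hθ', show ¬ s < b from not_lt.2 (le_of_lt hs)]
  · simp [hθ', EReal.coe_lt_coe_iff.1 htb]

end Solution

/-! ### The smallest eigenvalue of a symmetric matrix -/

section LambdaMin

open Matrix

variable {n : ℕ} {A B : Matrix (Fin n) (Fin n) ℝ}

theorem lambdaMin_mem_spectrum (hn : 0 < n) (hA : A.IsHermitian) : lambdaMin A ∈ spectrum ℝ A := by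
  have : Nonempty (Fin n) := ⟨⟨0, hn⟩⟩
  unfold lambdaMin
  rw [hA.spectrum_real_eq_range_eigenvalues]
  exact (range_nonempty _).csInf_mem (finite_range _)

theorem lambdaMin_le_of_mem_spectrum (hA : A.IsHermitian) {r : ℝ} (hr : r ∈ spectrum ℝ A) :
    lambdaMin A ≤ r := by
  refine csInf_le ?_ hr
  rw [hA.spectrum_real_eq_range_eigenvalues]
  exact (finite_range _).bddBelow

theorem lambdaMin_mul_le (hA : A.IsHermitian) (x : Fin n → ℝ) :
    lambdaMin A * (x ⬝ᵥ x) ≤ x ⬝ᵥ A *ᵥ x := by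
  have hB : (algebraMap ℝ (Matrix (Fin n) (Fin n) ℝ) (-lambdaMin A) + A).IsHermitian := by
    refine IsHermitian.add ?_ hA
    rw [Algebra.algebraMap_eq_smul_one]
    exact isHermitian_one.smul (IsSelfAdjoint.all _)
  -- Subtracting the smallest eigenvalue from `A` shifts the spectrum into `[0, ∞)`.
  have hpos : (algebraMap ℝ (Matrix (Fin n) (Fin n) ℝ) (-lambdaMin A) + A).PosSemidef := by
    refine hB.posSemidef_iff_eigenvalues_nonneg.2 fun i => ?_
    have h1 := hB.eigenvalues_mem_spectrum_real i
    have h2 : hB.eigenvalues i + lambdaMin A ∈ spectrum ℝ A := by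
      rwa [← spectrum.add_mem_add_iff (s := -lambdaMin A), add_neg_cancel_right]
    simpa using lambdaMin_le_of_mem_spectrum hA h2
  have h := hpos.dotProduct_mulVec_nonneg x
  rw [Algebra.algebraMap_eq_smul_one, add_mulVec, dotProduct_add, smul_mulVec, one_mulVec,
    dotProduct_smul] at h
  simp only [star_trivial, smul_eq_mul] at h
  linarith

theorem exists_dotProduct_mulVec_eq_lambdaMin (hn : 0 < n) (hA : A.IsHermitian) :
    ∃ x : Fin n → ℝ, x ⬝ᵥ x = 1 ∧ x ⬝ᵥ A *ᵥ x = lambdaMin A := by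
  have h := lambdaMin_mem_spectrum hn hA
  rw [hA.spectrum_real_eq_range_eigenvalues] at h
  obtain ⟨i, hi⟩ := h
  have h1 : (hA.eigenvectorBasis i).ofLp ⬝ᵥ (hA.eigenvectorBasis i).ofLp = 1 := by
    have h1 := EuclideanSpace.real_norm_sq_eq (hA.eigenvectorBasis i)
    rw [hA.eigenvectorBasis.orthonormal.1 i, one_pow] at h1
    simp only [dotProduct, ← sq, ← h1]
  refine ⟨_, h1, ?_⟩
  rw [hA.mulVec_eigenvectorBasis, dotProduct_smul, h1, hi, smul_eq_mul, mul_one]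

/-- Testing `A` on a unit eigenvector for the smallest eigenvalue of `B`, whose coordinates are at
most `1` in absolute value. Used both ways, this gives continuity of `lambdaMin`. -/
theorem lambdaMin_le_add (hn : 0 < n) (hA : A.IsHermitian) (hB : B.IsHermitian) :
    lambdaMin A ≤ lambdaMin B + ∑ i, ∑ j, |A i j - B i j| := by
  obtain ⟨x, hx, hxB⟩ := exists_dotProduct_mulVec_eq_lambdaMin hn hB
  have h1 := lambdaMin_mul_le hA x
  rw [hx, mul_one] at h1
  have hxi : ∀ i, |x i| ≤ 1 := fun i => by
    rw [← sq_le_one_iff_abs_le_one, ← hx, sq]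
    exact Finset.single_le_sum (f := fun i => x i * x i) (fun j _ => mul_self_nonneg _)
      (Finset.mem_univ i)
  have h2 : x ⬝ᵥ A *ᵥ x = x ⬝ᵥ B *ᵥ x + ∑ i, ∑ j, x i * ((A i j - B i j) * x j) := by
    have : x ⬝ᵥ A *ᵥ x = x ⬝ᵥ B *ᵥ x + x ⬝ᵥ (A - B) *ᵥ x := by
      rw [← dotProduct_add, ← add_mulVec, add_sub_cancel]
    rw [this]
    simp [dotProduct, mulVec, Finset.mul_sum]
  rw [h2, hxB] at h1
  refine h1.trans ?_
  gcongr with i _ j _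
  refine (le_abs_self _).trans ?_
  rw [abs_mul, abs_mul]
  have := hxi i
  have := hxi j
  calc |x i| * (|A i j - B i j| * |x j|) ≤ 1 * (|A i j - B i j| * 1) := by gcongr
    _ = _ := by ring

theorem continuousOn_lambdaMin (hn : 0 < n) {α : Type*} [TopologicalSpace α] {s : Set α}
    {M : α → Matrix (Fin n) (Fin n) ℝ} (hM : ∀ a, (M a).IsHermitian)
    (hc : ∀ i j, ContinuousOn (fun a => M a i j) s) : ContinuousOn (fun a => lambdaMin (M a)) s := by
  intro a ha
  refine tendsto_iff_dist_tendsto_zero.2 (squeeze_zero (fun _ => dist_nonneg)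
    (g := fun b => ∑ i, ∑ j, |M b i j - M a i j|) (fun b => ?_) ?_)
  · rw [Real.dist_eq, abs_sub_le_iff]
    have h1 := lambdaMin_le_add hn (hM b) (hM a)
    have h2 := lambdaMin_le_add hn (hM a) (hM b)
    simp_rw [abs_sub_comm (M a _ _)] at h2
    constructor <;> linarith
  · have h1 : Tendsto (fun b => ∑ i, ∑ j, |M b i j - M a i j|) (𝓝[s] a)
        (𝓝 (∑ i, ∑ j, |M a i j - M a i j|)) :=
      tendsto_finsetSum _ fun i _ => tendsto_finsetSum _ fun j _ =>
        ((hc i j a ha).sub tendsto_const_nhds).abs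
    simpa using h1

end LambdaMin

/-! ### The two-layer ReLU loss and its gradient lower bound -/

section Network

open Matrix

variable {N d₀ d₁ d₂ : ℕ} (X : Matrix (Fin N) (Fin d₀) ℝ) (Y : Matrix (Fin N) (Fin d₂) ℝ)

theorem isHermitian_hidden_mul_transpose (θ : Params d₀ d₁ d₂) :
    (hidden X θ * (hidden X θ)ᵀ).IsHermitian := by
  rw [← conjTranspose_eq_transpose_of_trivial]
  exact isHermitian_mul_conjTranspose_self _

theorem sigmaMin_hidden_transpose_sq (hN : 0 < N) (θ : Params d₀ d₁ d₂) :
    sigmaMin (hidden X θ)ᵀ ^ 2 = lambdaMin (hidden X θ * (hidden X θ)ᵀ) := by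
  rw [sigmaMin, transpose_transpose, Real.sq_sqrt]
  obtain ⟨x, -, hx⟩ := exists_dotProduct_mulVec_eq_lambdaMin hN
    (isHermitian_hidden_mul_transpose X θ)
  rw [← hx, ← mulVec_mulVec, dotProduct_mulVec, ← mulVec_transpose]
  exact Finset.sum_nonneg fun i _ => mul_self_nonneg _

theorem hidden_apply (θ : Params d₀ d₁ d₂) (i : Fin N) (j : Fin d₁) :
    hidden X θ i j = max (∑ l, X i l * θ (Sum.inl (l, j))) 0 := rfl

theorem continuous_hidden_apply (i : Fin N) (j : Fin d₁) :
    Continuous fun θ : Params d₀ d₁ d₂ => hidden X θ i j := by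
  simp only [hidden_apply]
  fun_prop

theorem output_apply (θ : Params d₀ d₁ d₂) (i : Fin N) (k : Fin d₂) :
    output X θ i k = ∑ j, hidden X θ i j * θ (Sum.inr (j, k)) := rfl

theorem continuous_output_apply (i : Fin N) (k : Fin d₂) :
    Continuous fun θ : Params d₀ d₁ d₂ => output X θ i k := by
  simp only [output_apply]
  have := continuous_hidden_apply (d₁ := d₁) (d₂ := d₂) X i
  fun_prop

/-- The loss of the network whose activation pattern is frozen to be `S`. -/
noncomputable def patternLoss (S : Fin N → Fin d₁ → Bool) (θ : Params d₀ d₁ d₂) : ℝ :=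
  1 / 2 * ∑ i, ∑ k, (Y i k - ∑ j, (if S i j then 1 else 0) *
    (∑ l, X i l * θ (Sum.inl (l, j))) * θ (Sum.inr (j, k))) ^ 2

theorem isPiecewiseSmooth_mseLoss :
    IsPiecewiseSmooth (mseLoss (d₁ := d₁) X Y) (patternLoss X Y) where
  continuous := by
    unfold mseLoss
    have := continuous_output_apply (d₁ := d₁) (d₂ := d₂) X
    fun_prop
  contDiff S := by
    unfold patternLoss
    fun_prop
  exists_eq θ := by
    refine ⟨fun i j => decide (0 < ∑ l, X i l * θ (Sum.inl (l, j))), ?_⟩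
    simp only [mseLoss, patternLoss, output_apply, hidden_apply, decide_eq_true_eq]
    refine congrArg _ (Finset.sum_congr rfl fun i _ => Finset.sum_congr rfl fun k _ => ?_)
    congr 2
    refine Finset.sum_congr rfl fun j _ => ?_
    split_ifs with h
    · rw [max_eq_left h.le, one_mul]
    · rw [max_eq_right (not_lt.1 h), zero_mul, zero_mul, zero_mul]

theorem mseLoss_nonneg (θ : Params d₀ d₁ d₂) : 0 ≤ mseLoss X Y θ := by
  unfold mseLoss; positivity

/-- The direction in parameter space that changes only the second layer. -/
noncomputable def outerDirection (Z : Matrix (Fin d₁) (Fin d₂) ℝ) : Params d₀ d₁ d₂ :=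
  WithLp.toLp 2 (Sum.elim (fun _ => 0) fun jk => Z jk.1 jk.2)

theorem hasDerivAt_mseLoss_outerDirection (θ : Params d₀ d₁ d₂) (Z : Matrix (Fin d₁) (Fin d₂) ℝ) :
    HasDerivAt (fun s : ℝ => mseLoss X Y (θ + s • outerDirection Z))
      (-∑ i, ∑ k, (Y i k - output X θ i k) * (hidden X θ * Z) i k) 0 := by
  have e : (fun s : ℝ => mseLoss X Y (θ + s • outerDirection Z)) = fun s =>
      1 / 2 * ∑ i, ∑ k, (Y i k - (output X θ i k + s * (hidden X θ * Z) i k)) ^ 2 := by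
    funext s
    simp only [mseLoss, output_apply, hidden_apply, outerDirection, PiLp.add_apply, PiLp.smul_apply,
      Sum.elim_inl, Sum.elim_inr, smul_eq_mul, mul_zero, add_zero, Matrix.mul_apply, mul_add,
      Finset.sum_add_distrib, Finset.mul_sum]
    refine Finset.sum_congr rfl fun i _ => Finset.sum_congr rfl fun k _ => ?_
    congr 4
    refine Finset.sum_congr rfl fun j _ => ?_
    ring
  rw [e]
  have h1 : ∀ i k, HasDerivAt
      (fun s : ℝ => (Y i k - (output X θ i k + s * (hidden X θ * Z) i k)) ^ 2)
      (2 * (Y i k - output X θ i k) * -(hidden X θ * Z) i k) 0 := by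
    intro i k
    have := ((((hasDerivAt_id (0 : ℝ)).mul_const ((hidden X θ * Z) i k)).const_add
      (output X θ i k)).const_sub (Y i k)).fun_pow 2
    simpa using this
  have h2 := (HasDerivAt.fun_sum (u := Finset.univ) fun i _ =>
    HasDerivAt.fun_sum (u := Finset.univ) fun k _ => h1 i k).const_mul (1 / 2 : ℝ)
  refine h2.congr_deriv ?_
  simp only [Finset.mul_sum, ← Finset.sum_neg_distrib]
  refine Finset.sum_congr rfl fun i _ => Finset.sum_congr rfl fun k _ => ?_
  ring

/-- On the open set where a piece agrees with the loss, its derivative in a second-layer direction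
is the explicit one. Both sides are continuous, so this persists on the closure, and then on the
convex hull by linearity. -/
theorem inner_outerDirection_of_mem_activeHull {θ g : Params d₀ d₁ d₂}
    (hg : g ∈ activeHull (mseLoss X Y) (patternLoss X Y) θ) (Z : Matrix (Fin d₁) (Fin d₂) ℝ) :
    inner ℝ g (outerDirection Z) =
      -∑ i, ∑ k, (Y i k - output X θ i k) * (hidden X θ * Z) i k := by
  have h := isPiecewiseSmooth_mseLoss (d₁ := d₁) X Y
  set D : Params d₀ d₁ d₂ → ℝ := fun θ =>
    -∑ i, ∑ k, (Y i k - output X θ i k) * (hidden X θ * Z) i k with hD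
  have hDc : Continuous D := by
    simp only [hD, Matrix.mul_apply]
    have h1 := continuous_output_apply (d₁ := d₁) (d₂ := d₂) X
    have h2 := continuous_hidden_apply (d₁ := d₁) (d₂ := d₂) X
    fun_prop
  suffices hsub : activeHull (mseLoss X Y) (patternLoss X Y) θ ⊆
      {g | inner ℝ g (outerDirection Z) = D θ} from hsub hg
  refine convexHull_min ?_ ?_
  · rintro _ ⟨S, hS, rfl⟩
    have hcl : IsClosed {y | inner ℝ (gradient (patternLoss X Y S) y) (outerDirection Z) = D y} :=
      _root_.isClosed_eq ((h.continuous_gradient S).inner continuous_const) hDc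
    refine closure_minimal (fun y hy => ?_) hcl hS
    have h1 := h.hasDerivAt_line S y (outerDirection Z) 0
    rw [zero_smul, add_zero] at h1
    refine (h1.congr_of_eventuallyEq ?_).unique (hasDerivAt_mseLoss_outerDirection X Y y Z)
    have hc : Tendsto (fun s : ℝ => y + s • outerDirection (d₀ := d₀) Z) (𝓝 0) (𝓝 y) := by
      have : Continuous fun s : ℝ => y + s • outerDirection (d₀ := d₀) Z := by fun_prop
      simpa using this.tendsto 0
    exact hc.eventually (mem_interior_iff_mem_nhds.1 hy)
  · intro g hg g' hg' a b _ _ hab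
    simp only [mem_ofPred_eq] at hg hg' ⊢
    rw [inner_add_left, inner_smul_left, inner_smul_left, hg, hg', ← add_mul]
    simp [hab]

/-- The Polyak–Łojasiewicz type inequality satisfied by all subgradients. -/
theorem sigmaMin_sq_mul_mseLoss_le (hN : 0 < N) {θ g : Params d₀ d₁ d₂}
    (hg : g ∈ activeHull (mseLoss X Y) (patternLoss X Y) θ) :
    2 * sigmaMin (hidden X θ)ᵀ ^ 2 * mseLoss X Y θ ≤ ‖g‖ ^ 2 := by
  set H := hidden X θ with hH
  set R : Matrix (Fin N) (Fin d₂) ℝ := Y - output X θ with hR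
  -- This is minus the gradient in `V`. Pairing `g` with this direction gives `-‖Z‖ ^ 2`, so
  -- Cauchy–Schwarz yields `‖Z‖ ≤ ‖g‖`.
  set Z : Matrix (Fin d₁) (Fin d₂) ℝ := Hᵀ * R with hZ
  have h1 := inner_outerDirection_of_mem_activeHull X Y hg Z
  have h2 : ∑ i, ∑ k, (Y i k - output X θ i k) * (H * Z) i k =
      ∑ k, (fun i => R i k) ⬝ᵥ (H * Hᵀ) *ᵥ fun i => R i k := by
    rw [Finset.sum_comm, hZ, ← Matrix.mul_assoc]
    rfl
  have h3 : ∑ k, (fun i => R i k) ⬝ᵥ (H * Hᵀ) *ᵥ (fun i => R i k) =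
      ‖outerDirection (d₀ := d₀) Z‖ ^ 2 := by
    rw [EuclideanSpace.norm_sq_eq, Fintype.sum_sum_type, Fintype.sum_prod_type_right]
    simp only [outerDirection, Sum.elim_inl, Sum.elim_inr, norm_zero, Real.norm_eq_abs, sq_abs]
    have : ∀ k, (fun i => R i k) ⬝ᵥ (H * Hᵀ) *ᵥ (fun i => R i k) = ∑ j, Z j k ^ 2 := by
      intro k
      rw [← mulVec_mulVec, dotProduct_mulVec, ← mulVec_transpose]
      simp [dotProduct, sq, hZ, Matrix.mul_apply, mulVec]
    simp_rw [this]
    simp [Fintype.sum_prod_type_right]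
  have h4 : 2 * mseLoss X Y θ * lambdaMin (H * Hᵀ) ≤ ‖outerDirection (d₀ := d₀) Z‖ ^ 2 := by
    rw [← h3]
    calc 2 * mseLoss X Y θ * lambdaMin (H * Hᵀ)
        = ∑ k, lambdaMin (H * Hᵀ) * ((fun i => R i k) ⬝ᵥ fun i => R i k) := by
          rw [← Finset.mul_sum, mseLoss, Finset.sum_comm]
          simp only [dotProduct, hR, Matrix.sub_apply, ← sq]
          ring
      _ ≤ _ := Finset.sum_le_sum fun k _ =>
          lambdaMin_mul_le (isHermitian_hidden_mul_transpose X θ) _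
  rw [h2, h3] at h1
  have h5 : ‖outerDirection (d₀ := d₀) Z‖ ^ 2 ≤ ‖g‖ * ‖outerDirection (d₀ := d₀) Z‖ := by
    have := neg_le_of_abs_le (abs_real_inner_le_norm g (outerDirection Z))
    linarith
  have h6 : ‖outerDirection (d₀ := d₀) Z‖ ≤ ‖g‖ := by
    by_contra! hlt
    nlinarith [norm_nonneg g, norm_nonneg (outerDirection (d₀ := d₀) Z)]
  rw [sigmaMin_hidden_transpose_sq X hN]
  have h7 := pow_le_pow_left₀ (norm_nonneg _) h6 2
  linarith

theorem continuousOn_sigmaMin_sq (hN : 0 < N) {θ : ℝ → Params d₀ d₁ d₂} {s : Set ℝ}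
    (hθ : ContinuousOn θ s) : ContinuousOn (fun r => sigmaMin (hidden X (θ r))ᵀ ^ 2) s := by
  simp_rw [sigmaMin_hidden_transpose_sq X hN]
  refine continuousOn_lambdaMin hN (fun r => isHermitian_hidden_mul_transpose X (θ r)) fun i j => ?_
  simp only [Matrix.mul_apply, transpose_apply]
  exact continuousOn_finsetSum _ fun k _ =>
    ((continuous_hidden_apply X i k).comp_continuousOn hθ).mul
      ((continuous_hidden_apply X j k).comp_continuousOn hθ)

end Network

end ReluNet

theorem proposition2p1 {N d₀ d₁ d₂ : ℕ} (hN : 0 < N) (hd₀ : 0 < d₀) (hd₁ : 0 < d₁) (hd₂ : 0 < d₂)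
    (X : Matrix (Fin N) (Fin d₀) ℝ) (Y : Matrix (Fin N) (Fin d₂) ℝ)
    (θ₀ : ReluNet.Params d₀ d₁ d₂) :
    -- a local solution exists
    (∃ T : EReal, 0 < T ∧ ∃ θ : ℝ → ReluNet.Params d₀ d₁ d₂,
      ReluNet.IsSolution (ReluNet.mseLoss X Y) θ₀ T θ) ∧
    -- every solution extends to infinity or until it hits the boundary of a bounded domain
    (∀ G : Set (ReluNet.Params d₀ d₁ d₂), IsOpen G → IsConnected G → Bornology.IsBounded G →
      θ₀ ∈ G → ∀ (T : EReal) (θ : ℝ → ReluNet.Params d₀ d₁ d₂), 0 < T →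
      ReluNet.IsSolution (ReluNet.mseLoss X Y) θ₀ T θ →
      ∃ (T' : EReal) (θ' : ℝ → ReluNet.Params d₀ d₁ d₂), T ≤ T' ∧
        ReluNet.IsSolution (ReluNet.mseLoss X Y) θ₀ T' θ' ∧
        (∀ t : ℝ, 0 ≤ t → (t : EReal) < T → θ' t = θ t) ∧
        (T' = ⊤ ∨ ∃ t : ℝ, 0 ≤ t ∧ (t : EReal) < T' ∧ θ' t ∈ frontier G)) ∧
    -- every solution satisfies the exponential loss bound
    (∀ (T : EReal) (θ : ℝ → ReluNet.Params d₀ d₁ d₂), 0 < T →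
      ReluNet.IsSolution (ReluNet.mseLoss X Y) θ₀ T θ →
      ∀ t : ℝ, 0 ≤ t → (t : EReal) < T →
        IntervalIntegrable (fun s => ReluNet.sigmaMin (ReluNet.hidden X (θ s)).transpose ^ 2)
          volume 0 t ∧
        ReluNet.mseLoss X Y (θ t) ≤ ReluNet.mseLoss X Y (θ 0) *
          Real.exp (-2 * ∫ s in (0 : ℝ)..t,
            ReluNet.sigmaMin (ReluNet.hidden X (θ s)).transpose ^ 2)) := by 
  have h := ReluNet.isPiecewiseSmooth_mseLoss (d₁ := d₁) X Y
  have h0 := ReluNet.mseLoss_nonneg (d₁ := d₁) X Y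
  refine ⟨⟨⊤, EReal.zero_lt_top, h.exists_isSolution_top h0 θ₀⟩, ?_, ?_⟩
  · intro G _ _ _ _ T θ hT hθ
    obtain ⟨θ', hθ', heq⟩ := h.exists_extension_top h0 hT hθ
    exact ⟨⊤, θ', le_top, hθ', heq, Or.inl rfl⟩
  · intro T θ _ hθ t ht htT
    have hσ := ReluNet.continuousOn_sigmaMin_sq X hN (hθ.arc.continuousOn ht htT)
    refine ⟨ContinuousOn.intervalIntegrable (by rwa [uIcc_of_le ht]),
      ReluNet.le_mul_exp_of_ae_deriv_le ht (h.absolutelyContinuousOnInterval_arc hθ.arc ht htT)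
        hσ ?_⟩
    filter_upwards [h.ae_hasDerivAt_comp hθ ht htT] with s hs hst
    obtain ⟨d, -, hd, hD⟩ := hs hst
    refine ⟨_, hD, neg_le_neg ?_⟩
    simpa using ReluNet.sigmaMin_sq_mul_mseLoss_le X Y hN hd
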